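/- Let $p$ be an odd prime, let $n\ge 2$ be an integer, let $F$ be a finite field of order $p^n$ and let $L$ be a quadratic extension of $F$. Let $\mu(x)=e^{2\pi i\,\mathrm{Tr}_{L/\mathbb F_p}(x)/p}$ be the canonical additive character of $L$, and for a positive integer $s$ and $a\in L$ put $W_{L,s}(a)=\sum_{x\in L}\mu(x^s-ax)$. The Weil spectrum over $L$ (for the exponent $s$) is the set $\{W_{L,s}(a): a\in L^\times\}$. Let $k\ge 2$ be an integer with $k<\frac p2+1$, and suppose that $s=1+k(p^n-1)$ is an invertible Niho exponent over $L$; that is, $\gcd(s,p^{2n}-1)=1$, $s$ is not congruent to a power of $p$ modulo $p^{2n}-1$, and $s$ is congruent to a power of $p$ modulo $p^n-1$. Let $d_1=\gcd(k,p^n+1)$ and $d_2=\gcd(k-1,p^n+1)$. If $d_1+d_2\ge 5$, then the Weil spectrum over $L$ contains at least five distinct values. Moreover, there are integers $\alpha,\beta\ge 1$ such that $0$, $-p^n$, $2\alpha p^n$ and $(2\beta+1)p^n$ all belong to the Weil spectrum over $L$. -/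

import Mathlib

/-- The canonical additive character `x ↦ exp (2πi · Tr(x) / p)` of a finite field `K` of
characteristic `p`, where `Tr : K → 𝔽_p` is the absolute trace. (The algebra structure of `K`
over `ZMod p` is unique, and exists exactly when `K` has characteristic `p`.) -/
noncomputable def canonicalChar (p : ℕ) (K : Type*) [Field K] [Algebra (ZMod p) K] (x : K) : ℂ :=
  Complex.exp (2 * Real.pi * Complex.I * ((Algebra.trace (ZMod p) K x).val : ℂ) / (p : ℂ))

/-- The Weil sum `W_{K,s}(a) = ∑_{x ∈ K} μ(x^s - a x)`, with `μ` the canonical additive character. -/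
noncomputable def weilSum (p : ℕ) (K : Type*) [Field K] [Fintype K] [Algebra (ZMod p) K]
    (s : ℕ) (a : K) : ℂ :=
  ∑ x : K, canonicalChar p K (x ^ s - a * x)

/-- The Weil spectrum `{W_{K,s}(a) | a ∈ Kˣ}`. -/
def weilSpectrum (p : ℕ) (K : Type*) [Field K] [Fintype K] [Algebra (ZMod p) K]
    (s : ℕ) : Set ℂ :=
  {w | ∃ a : K, a ≠ 0 ∧ weilSum p K s a = w}

/-- `s` is an invertible exponent over a finite field `K`: `gcd(s, |K| - 1) = 1`. -/
def IsInvertibleExponent (K : Type*) (s : ℕ) : Prop :=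
  Nat.Coprime s (Nat.card K - 1)

/-- `s` is a Niho exponent over the field of order `p^(2n)`: it is not congruent to a power of `p`
modulo `p^(2n) - 1`, but it is congruent to a power of `p` modulo `p^n - 1`. -/
def IsNihoExponent (p n s : ℕ) : Prop :=
  (¬ ∃ j : ℕ, s ≡ p ^ j [MOD p ^ (2 * n) - 1]) ∧ ∃ j : ℕ, s ≡ p ^ j [MOD p ^ n - 1]

/-! Put `q = p^n` and `j = k - 1`. Niho's method scales `x` by the subfield of order `q`, realised
inside `L` as the fixed points of `x ↦ x^q`. It gives `W(a) = q (N(a) - 1)`, where `N(a)` counts the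
norm-one `v` with `v^(2j+1) + 1 = a v^j + a^q v^(j+1)` (`charWeilSum_eq`). So `M = W/q` is an
integer, at least `-1`.

At `a = 1` the equation is `(v^(j+1) - 1)(v^j - 1) = 0`, so `B = M(1) = d₁ + d₂ - 2 ≥ 3`. For `a` in
the subfield inversion permutes the roots; `-1` is always a root, while `1` is one only for `a = 1`.
Hence `B` is odd, and `M` is even and nonnegative at the other subfield points. Its sum over the
subfield is `q`; as `2 ≤ B < q`, this forces a positive even value `A`, and a zero of `M` at a
nonzero point.

Over `L`, `∑ M = q`, `∑ M² = q²` and `∑ M³ = q V`, where `V` counts the solutions of `t^s + 1 =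
(t+1)^s`. The first two moments force the value `-1`. Moreover `V = q + C` with `C ≤ B² - B < q`
(`card_filter_add_one_le`). If `-1, 0, A, B` were the only values, consider `∑ M(M+1)(M-A)` and `∑
M(M+1)(M-B)`. When `A ≥ 4` the moments make both negative, but the one that isolates the larger of
`A, B` is positive. When `A = 2`, `B(B+1)(B-2)` is prime to `p` and so divides the smaller positive
number `C - 2` (`exists_value_notMem`). -/

open Finset

/-! ### The norm-one group, and Niho's equation as a vanishing relative trace -/

section UnitCircle

variable {L : Type*} [Field L] [Fintype L] [DecidableEq L] {q : ℕ}

/-- The fixed points of `x ↦ x ^ q`: the subfield of order `q` when `L` has order `q ^ 2`. -/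
def fixedPts (L : Type*) [Field L] [Fintype L] [DecidableEq L] (q : ℕ) : Finset L :=
  univ.filter fun x => x ^ q = x

/-- The elements of norm one relative to the subfield of order `q`. -/
def unitCircle (L : Type*) [Field L] [Fintype L] [DecidableEq L] (q : ℕ) : Finset L :=
  univ.filter fun v => v ^ (q + 1) = 1

/-- The points of the unit circle that solve Niho's equation for the exponent
`1 + (j + 1) * (q - 1)`. -/
def nihoRoots (q j : ℕ) (a : L) : Finset L :=
  (unitCircle L q).filter fun v => v ^ (2 * j + 1) + 1 = a * v ^ j + a ^ q * v ^ (j + 1)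

omit [DecidableEq L] in
theorem exists_generator : ∃ g : L, g ≠ 0 ∧ orderOf g = Fintype.card L - 1 ∧
    ∀ x : L, x ≠ 0 → ∃ i : ℕ, g ^ i = x := by
  obtain ⟨g, hg⟩ := IsCyclic.exists_generator (α := Lˣ)
  refine ⟨g, g.ne_zero, ?_, fun x hx => ?_⟩
  · rw [orderOf_units, orderOf_eq_card_of_forall_mem_zpowers hg, Nat.card_units,
      Nat.card_eq_fintype_card]
  · obtain ⟨i, hi⟩ := (mem_powers_iff_mem_zpowers).2 (hg (Units.mk0 x hx))
    exact ⟨i, by simpa using congrArg Units.val hi⟩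

theorem card_filter_pow_eq_one {d : ℕ} (hd : d ∣ Fintype.card L - 1) :
    (univ.filter fun x : L => x ^ d = 1).card = d := by
  obtain ⟨g, hg0, hg, -⟩ := exists_generator (L := L)
  have hpos : 0 < Fintype.card L - 1 := Nat.sub_pos_of_lt Fintype.one_lt_card
  have hd0 : 0 < d := Nat.pos_of_dvd_of_pos hd hpos
  obtain ⟨e, he⟩ := hd
  have hp : IsPrimitiveRoot (g ^ e) d :=
    (IsPrimitiveRoot.orderOf g).pow (hg ▸ hpos) (by rw [hg, he, mul_comm])
  refine Eq.trans (congrArg card ?_) hp.card_nthRootsFinset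
  ext x
  simp [Polynomial.mem_nthRootsFinset hd0]

theorem card_unitCircle (hcard : Fintype.card L = q ^ 2) : (unitCircle L q).card = q + 1 := by
  refine card_filter_pow_eq_one ⟨q - 1, ?_⟩
  rw [hcard]
  simpa using Nat.sq_sub_sq q 1

theorem fixedPts_eq (hq : 1 < q) :
    fixedPts L q = insert 0 (univ.filter fun x : L => x ^ (q - 1) = 1) := by
  ext x
  obtain ⟨m, rfl⟩ : ∃ m, q = m + 1 := ⟨q - 1, by omega⟩
  have hm : m ≠ 0 := by omega
  simp only [fixedPts, mem_filter, mem_univ, true_and, mem_insert, Nat.add_sub_cancel]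
  by_cases hx : x = 0
  · simp [hx]
  · rw [pow_succ]; simp [hx]

theorem card_fixedPts (hcard : Fintype.card L = q ^ 2) (hq : 1 < q) :
    (fixedPts L q).card = q := by
  rw [fixedPts_eq hq, card_insert_of_notMem, card_filter_pow_eq_one ⟨q + 1, ?_⟩]
  · omega
  · rw [hcard, mul_comm]
    simpa using Nat.sq_sub_sq q 1
  · simp [zero_pow (show q - 1 ≠ 0 by omega)]

omit [DecidableEq L] in
theorem pow_pow_eq_self (hcard : Fintype.card L = q ^ 2) (x : L) : (x ^ q) ^ q = x := by
  rw [← pow_mul, ← sq, ← hcard, FiniteField.pow_card]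

omit [DecidableEq L] in
theorem pow_sub_one_pow_add_one (hcard : Fintype.card L = q ^ 2) {x : L} (hx : x ≠ 0) :
    (x ^ (q - 1)) ^ (q + 1) = 1 := by
  rw [← pow_mul, ← FiniteField.pow_card_sub_one_eq_one x hx, hcard, mul_comm]
  congr 1
  simpa using (Nat.sq_sub_sq q 1).symm

omit [DecidableEq L] in
-- Hilbert 90, read off from the exponent of `v` with respect to a generator.
theorem exists_pow_sub_one_eq (hcard : Fintype.card L = q ^ 2) {v : L}
    (hv : v ^ (q + 1) = 1) : ∃ x : L, x ≠ 0 ∧ x ^ (q - 1) = v := by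
  obtain ⟨g, hg0, hg, hgen⟩ := exists_generator (L := L)
  have hv0 : v ≠ 0 := by rintro rfl; simp at hv
  obtain ⟨i, rfl⟩ := hgen v hv0
  rw [← pow_mul, ← orderOf_dvd_iff_pow_eq_one, hg, hcard] at hv
  have h : q ^ 2 - 1 = (q - 1) * (q + 1) := by
    rw [mul_comm]; simpa using Nat.sq_sub_sq q 1
  rw [h] at hv
  obtain ⟨c, rfl⟩ := Nat.dvd_of_mul_dvd_mul_right (by omega) hv
  exact ⟨g ^ c, pow_ne_zero _ hg0, by rw [← pow_mul, mul_comm]⟩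

theorem card_fiber_pow_sub_one (hcard : Fintype.card L = q ^ 2) (hq : 1 < q) {v : L}
    (hv : v ^ (q + 1) = 1) : (univ.filter fun x : L => x ≠ 0 ∧ x ^ (q - 1) = v).card = q - 1 := by
  obtain ⟨y, hy, rfl⟩ := exists_pow_sub_one_eq hcard hv
  have hd : q - 1 ∣ Fintype.card L - 1 :=
    ⟨q + 1, by rw [hcard, mul_comm]; simpa using Nat.sq_sub_sq q 1⟩
  have h1 : q - 1 ≠ 0 := by omega
  refine Eq.trans ?_ (card_filter_pow_eq_one (L := L) hd)
  refine card_nbij' (fun x => x / y) (fun r => r * y) ?_ ?_ ?_ ?_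
  · intro x hx
    simp only [coe_filter, mem_univ, true_and, Set.mem_ofPred_eq] at hx ⊢
    rw [div_pow, hx.2, div_self (pow_ne_zero _ hy)]
  · intro r hr
    simp only [coe_filter, mem_univ, true_and, Set.mem_ofPred_eq] at hr ⊢
    refine ⟨mul_ne_zero ?_ hy, by rw [mul_pow, hr, one_mul]⟩
    rintro rfl
    simp [zero_pow h1] at hr
  · intro x _
    exact div_mul_cancel₀ x hy
  · intro x _
    exact mul_div_cancel_right₀ x hy

omit [DecidableEq L] in
-- With `v = x^(q-1)` one has `x^q = x v` and `v^q = v⁻¹`, so after multiplication by `v^j` the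
-- trace is `x` times the difference of the two sides of Niho's equation.
theorem trace_eq_zero_iff (hcard : Fintype.card L = q ^ 2)
    (hadd : ∀ x y : L, (x + y) ^ q = x ^ q + y ^ q) (hq : 1 < q) (j : ℕ) (a : L) {x : L}
    (hx : x ≠ 0) :
    (x ^ (1 + (j + 1) * (q - 1)) - a * x) + (x ^ (1 + (j + 1) * (q - 1)) - a * x) ^ q = 0 ↔
      (x ^ (q - 1)) ^ (2 * j + 1) + 1 =
        a * (x ^ (q - 1)) ^ j + a ^ q * (x ^ (q - 1)) ^ (j + 1) := by
  set v := x ^ (q - 1) with hv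
  have hxq : x ^ q = x * v := by rw [hv, ← pow_succ']; congr 1; omega
  have hvq : v ^ q * v = 1 := by rw [← pow_succ]; exact pow_sub_one_pow_add_one hcard hx
  have hv0 : v ≠ 0 := pow_ne_zero _ hx
  have e1 : x ^ (1 + (j + 1) * (q - 1)) - a * x = x * (v ^ (j + 1) - a) := by
    rw [pow_add, mul_comm (j + 1), pow_mul]; ring
  have hsub : (v ^ (j + 1) - a) ^ q = (v ^ (j + 1)) ^ q - a ^ q := by
    rw [eq_sub_iff_add_eq, ← hadd, sub_add_cancel]
  have e2 : (x * (v ^ (j + 1) - a)) ^ q * v ^ j = x * (1 - a ^ q * v ^ (j + 1)) := by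
    rw [mul_pow, hxq, hsub]
    have : (v ^ (j + 1)) ^ q * v ^ (j + 1) = 1 := by
      rw [pow_right_comm, ← mul_pow, hvq, one_pow]
    linear_combination x * this
  rw [e1]
  constructor
  · intro h
    have h2 := congrArg (· * v ^ j) h
    simp only [add_mul, zero_mul, e2] at h2
    apply mul_left_cancel₀ hx
    linear_combination h2
  · intro h
    apply mul_right_cancel₀ (pow_ne_zero j hv0)
    rw [add_mul, zero_mul, e2]
    linear_combination x * h

theorem card_filter_trace_eq_zero (hcard : Fintype.card L = q ^ 2)
    (hadd : ∀ x y : L, (x + y) ^ q = x ^ q + y ^ q) (hq : 1 < q) (j : ℕ) (a : L) :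
    (univ.filter fun x : L => x ≠ 0 ∧ (x ^ (1 + (j + 1) * (q - 1)) - a * x) +
      (x ^ (1 + (j + 1) * (q - 1)) - a * x) ^ q = 0).card = (q - 1) * (nihoRoots q j a).card := by
  rw [card_eq_sum_card_fiberwise (f := fun x => x ^ (q - 1)) (t := nihoRoots q j a),
    mul_comm (q - 1) (card _)]
  · refine sum_const_nat fun v hv => ?_
    simp only [nihoRoots, unitCircle, mem_filter, mem_univ, true_and] at hv
    rw [filter_filter]
    refine Eq.trans (congrArg card ?_) (card_fiber_pow_sub_one hcard hq hv.1)
    refine filter_congr fun x _ => ⟨fun h => ⟨h.1.1, h.2⟩, ?_⟩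
    rintro ⟨hx, rfl⟩
    exact ⟨⟨hx, (trace_eq_zero_iff hcard hadd hq j a hx).2 hv.2⟩, rfl⟩
  · intro x hx
    simp only [coe_filter, mem_univ, true_and, Set.mem_ofPred_eq, nihoRoots, unitCircle,
      mem_filter] at hx ⊢
    exact ⟨pow_sub_one_pow_add_one hcard hx.1, (trace_eq_zero_iff hcard hadd hq j a hx.1).1 hx.2⟩

end UnitCircle

/-! ### Power moments of Weil sums, and Niho's evaluation -/

section CharacterSums

variable {L : Type*} [Field L] [Fintype L] [DecidableEq L] {q : ℕ}

/-- The sum `∑ ψ (x ^ s - a * x)` for an arbitrary additive character `ψ`. -/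
noncomputable def charWeilSum (ψ : AddChar L ℂ) (s : ℕ) (a : L) : ℂ :=
  ∑ x : L, ψ (x ^ s - a * x)

omit [DecidableEq L] in
theorem pow_bijective_of_coprime {s : ℕ} (hs0 : s ≠ 0)
    (hs : s.Coprime (Fintype.card L - 1)) :
    Function.Bijective fun x : L => x ^ s := by
  rw [← Finite.injective_iff_bijective]
  intro x y h
  simp only at h
  by_cases hy : y = 0
  · subst hy
    rw [zero_pow hs0] at h
    exact pow_eq_zero_iff hs0 |>.1 h
  have hx : x ≠ 0 := by
    rintro rfl
    rw [zero_pow hs0] at h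
    exact hy (pow_eq_zero_iff hs0 |>.1 h.symm)
  have h1 : (x / y) ^ s = 1 := by rw [div_pow, h, div_self (pow_ne_zero _ hy)]
  have h2 := FiniteField.pow_card_sub_one_eq_one (x / y) (div_ne_zero hx hy)
  have h3 := pow_gcd_eq_one.2 ⟨h1, h2⟩
  rw [hs.gcd_eq_one, pow_one, div_eq_one_iff_eq hy] at h3
  exact h3

theorem sum_char_sub_mul {ψ : AddChar L ℂ} (hψ : ψ.IsPrimitive) (c b : L) :
    ∑ a : L, ψ (c - a * b) = if b = 0 then (Fintype.card L : ℂ) * ψ c else 0 := by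
  have h : ∀ a : L, ψ (c - a * b) = ψ c * ψ (a * (-b)) := fun a => by
    rw [← AddChar.map_add_eq_mul]; congr 1; ring
  simp_rw [h, ← mul_sum, AddChar.sum_mulShift _ hψ, neg_eq_zero]
  split_ifs <;> simp [mul_comm]

theorem sum_charWeilSum {ψ : AddChar L ℂ} (hψ : ψ.IsPrimitive) {s : ℕ} (hs : s ≠ 0) :
    ∑ a : L, charWeilSum ψ s a = Fintype.card L := by
  simp_rw [charWeilSum]
  rw [sum_comm]
  simp_rw [sum_char_sub_mul hψ]
  simp [zero_pow hs]

theorem sum_charWeilSum_sq {ψ : AddChar L ℂ} (hψ : ψ.IsPrimitive) {s : ℕ} (hs : Odd s) :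
    ∑ a : L, charWeilSum ψ s a ^ 2 = (Fintype.card L : ℂ) ^ 2 := by
  have h : ∀ a : L, charWeilSum ψ s a ^ 2 =
      ∑ x : L, ∑ y : L, ψ (x ^ s + y ^ s - a * (x + y)) := fun a => by
    rw [sq, charWeilSum, sum_mul_sum]
    refine sum_congr rfl fun x _ => sum_congr rfl fun y _ => ?_
    rw [← AddChar.map_add_eq_mul]; congr 1; ring
  simp_rw [h]
  rw [sum_comm]
  have h2 : ∀ x : L, ∑ a : L, ∑ y : L, ψ (x ^ s + y ^ s - a * (x + y)) = Fintype.card L := by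
    intro x
    rw [sum_comm]
    simp_rw [sum_char_sub_mul hψ, add_eq_zero_iff_neg_eq]
    simp [hs.neg_pow]
  simp_rw [h2]
  simp [sq]

theorem sum_charWeilSum_cube {ψ : AddChar L ℂ} (hψ : ψ.IsPrimitive) {s : ℕ} (hs : Odd s) :
    ∑ a : L, charWeilSum ψ s a ^ 3 =
      Fintype.card L * ∑ x : L, ∑ y : L, ψ (x ^ s + y ^ s - (x + y) ^ s) := by
  have h : ∀ a : L, charWeilSum ψ s a ^ 3 =
      ∑ x : L, ∑ y : L, ∑ z : L, ψ (x ^ s + y ^ s + z ^ s - a * (x + y + z)) := fun a => by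
    rw [pow_succ, sq, charWeilSum, sum_mul_sum, sum_mul]
    refine sum_congr rfl fun x _ => ?_
    rw [sum_mul_sum]
    refine sum_congr rfl fun y _ => sum_congr rfl fun z _ => ?_
    rw [← AddChar.map_add_eq_mul, ← AddChar.map_add_eq_mul]; congr 1; ring
  simp_rw [h]
  rw [sum_comm, mul_sum]
  refine sum_congr rfl fun x _ => ?_
  rw [sum_comm, mul_sum]
  refine sum_congr rfl fun y _ => ?_
  rw [sum_comm]
  simp_rw [sum_char_sub_mul hψ, add_eq_zero_iff_neg_eq (a := x + y)]
  simp [hs.neg_pow, sub_eq_add_neg, -neg_add_rev]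

theorem card_filter_homogeneous (s : ℕ) (hs : s ≠ 0) :
    (univ.filter fun x : L × L => x.1 ^ s + x.2 ^ s - (x.1 + x.2) ^ s = 0).card =
      Fintype.card L +
        (Fintype.card L - 1) * (univ.filter fun t : L => t ^ s + 1 = (t + 1) ^ s).card := by
  rw [card_eq_sum_card_fiberwise (f := Prod.snd) (t := univ) (by simp),
    ← add_sum_erase _ _ (mem_univ 0)]
  congr 1
  · rw [filter_filter, ← card_univ]
    refine card_nbij' Prod.fst (fun x => (x, 0)) (by simp) (by simp [hs]) ?_
      (fun _ _ => rfl)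
    rintro ⟨x, y⟩ h
    simp at h
    simp [h.2]
  · rw [← card_univ, ← card_erase_of_mem (mem_univ (0 : L))]
    refine sum_const_nat fun y hy => ?_
    have hy0 : y ≠ 0 := by simpa using hy
    rw [filter_filter]
    refine card_nbij' (fun x => x.1 / y) (fun t => (t * y, y)) ?_ ?_ ?_ ?_
    · rintro ⟨x, z⟩ h
      simp only [coe_filter, mem_univ, true_and, Set.mem_ofPred_eq] at h ⊢
      obtain ⟨h, rfl⟩ := h
      rw [div_add_one hy0, div_pow, div_pow, div_add_one (pow_ne_zero _ hy0)]
      rw [sub_eq_zero.1 h]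
    · intro t h
      simp only [coe_filter, mem_univ, true_and, Set.mem_ofPred_eq] at h ⊢
      refine ⟨?_, trivial⟩
      have : t * y + y = (t + 1) * y := by ring
      rw [this, mul_pow, mul_pow, ← h]; ring
    · rintro ⟨x, z⟩ h
      simp only [coe_filter, mem_univ, true_and, Set.mem_ofPred_eq] at h
      simp [hy0, h.2]
    · intro t _
      simp [hy0]

/-- The form has degree `s`, and `r ↦ r^s` permutes `L`. Scaling `(x, y)` by every `r` therefore
turns the sum into a count of zeros of the form, which reduces to affine solutions by dividing by
`y`. -/
theorem sum_sum_char_homogeneous {ψ : AddChar L ℂ} (hψ : ψ.IsPrimitive) {s : ℕ} (hs0 : s ≠ 0)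
    (hs : s.Coprime (Fintype.card L - 1)) :
    ∑ x : L, ∑ y : L, ψ (x ^ s + y ^ s - (x + y) ^ s) =
      Fintype.card L * (univ.filter fun t : L => t ^ s + 1 = (t + 1) ^ s).card := by
  set Q : ℂ := ((Fintype.card L : ℕ) : ℂ) with hQ
  set V : ℂ := (((univ.filter fun t : L => t ^ s + 1 = (t + 1) ^ s).card : ℕ) : ℂ) with hV
  set S := ∑ x : L, ∑ y : L, ψ (x ^ s + y ^ s - (x + y) ^ s) with hS
  have hS' : S = ∑ x : L × L, ψ (x.1 ^ s + x.2 ^ s - (x.1 + x.2) ^ s) := by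
    rw [Fintype.sum_prod_type]
  have h1 : ∀ r : L, r ≠ 0 →
      ∑ x : L × L, ψ (r ^ s * (x.1 ^ s + x.2 ^ s - (x.1 + x.2) ^ s)) = S := by
    intro r hr
    rw [hS']
    refine Fintype.sum_bijective (fun x : L × L => (r * x.1, r * x.2)) ?_ _ _ fun x => ?_
    · exact (mulLeft_bijective₀ r hr).prodMap (mulLeft_bijective₀ r hr)
    · simp only
      rw [← mul_add, mul_pow, mul_pow, mul_pow]; congr 1; ring
  have h2 : ∑ r : L, ∑ x : L × L, ψ (r ^ s * (x.1 ^ s + x.2 ^ s - (x.1 + x.2) ^ s)) =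
      Q * (Q + (Q - 1) * V) := by
    rw [sum_comm]
    have h3 : ∀ c : L, ∑ r : L, ψ (r ^ s * c) = if c = 0 then Q else 0 := by
      intro c
      rw [(pow_bijective_of_coprime hs0 hs).sum_comp (fun r => ψ (r * c)),
        AddChar.sum_mulShift _ hψ]
      split_ifs <;> simp [hQ]
    simp_rw [h3]
    rw [← sum_filter, sum_const, card_filter_homogeneous s hs0, nsmul_eq_mul]
    push_cast [Nat.cast_sub (Fintype.card_pos (α := L))]
    ring
  rw [← add_sum_erase _ _ (mem_univ 0), sum_congr rfl (fun r hr => h1 r (ne_of_mem_erase hr)),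
    sum_const, card_erase_of_mem (mem_univ _), nsmul_eq_mul, card_univ,
    Nat.cast_sub Fintype.card_pos] at h2
  simp only [zero_pow hs0, zero_mul, AddChar.map_zero_eq_one, sum_const, card_univ,
    Fintype.card_prod, nsmul_eq_mul, mul_one, Nat.cast_mul, ← hQ, Nat.cast_one] at h2
  have hQ1 : Q - 1 ≠ 0 := by
    rw [sub_ne_zero, hQ]
    exact_mod_cast Fintype.one_lt_card.ne'
  apply mul_left_cancel₀ hQ1
  linear_combination h2

omit [Fintype L] [DecidableEq L] in
theorem char_two_mul_mul {ψ : AddChar L ℂ} (hψq : ∀ x, ψ (x ^ q) = ψ x) {r y : L}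
    (hr : r ^ q = r) : ψ (2 * (r * y)) = ψ (r * (y + y ^ q)) := by
  rw [two_mul, mul_add, AddChar.map_add_eq_mul, AddChar.map_add_eq_mul]
  congr 1
  rw [← hψq, mul_pow, hr]

theorem sum_fixedPts_char {ψ : AddChar L ℂ} (hψ : ψ ≠ 1) (hψq : ∀ x, ψ (x ^ q) = ψ x)
    (hcard : Fintype.card L = q ^ 2) (hadd : ∀ x y : L, (x + y) ^ q = x ^ q + y ^ q)
    (hq : 1 < q) (h2 : (2 : L) ≠ 0) (y : L) :
    ∑ r ∈ fixedPts L q, ψ (r * y) = if y + y ^ q = 0 then (q : ℂ) else 0 := by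
  have : NeZero (2 : L) := ⟨h2⟩
  have h2q : (2 : L) ^ q = 2 := by
    rw [← one_add_one_eq_two, hadd, one_pow]
  have hhalf : ∀ r : L, r ^ q = r → ψ (r * y) = ψ (r / 2 * (y + y ^ q)) := by
    intro r hr
    rw [← char_two_mul_mul hψq (by rw [div_pow, hr, h2q])]
    congr 1
    field_simp
  split_ifs with hy
  · rw [sum_congr rfl (g := fun _ => (1 : ℂ)), sum_const, card_fixedPts hcard hq]
    · simp
    · intro r hr
      rw [hhalf r (by simpa [fixedPts] using hr), hy, mul_zero, AddChar.map_zero_eq_one]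
  · set c := y + y ^ q with hc
    have hcq : c ^ q = c := by rw [hc, hadd, pow_pow_eq_self hcard, add_comm]
    obtain ⟨r, hr, hr1⟩ : ∃ r : L, r ^ q = r ∧ ψ (r * y) ≠ 1 := by
      by_contra! hall
      refine hψ (DFunLike.ext _ _ fun z => ?_)
      -- This `r` gives `ψ (r * y) = ψ (z/2) ψ ((z/2)^q) = ψ z`, so triviality on all `r` would make
      -- `ψ` trivial.
      have h1 := hall ((z + z ^ q) / c) (by
        rw [div_pow, hcq, hadd, pow_pow_eq_self hcard, add_comm])
      rw [hhalf _ (by rw [div_pow, hcq, hadd, pow_pow_eq_self hcard, add_comm])] at h1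
      have h3 : (z + z ^ q) / c / 2 * c = z / 2 + (z / 2) ^ q := by
        rw [div_pow, h2q]; field_simp
      rw [h3, AddChar.map_add_eq_mul, hψq, ← AddChar.map_add_eq_mul, add_halves] at h1
      simpa using h1
    have hshift : ∑ t ∈ fixedPts L q, ψ (t * y) = ∑ t ∈ fixedPts L q, ψ ((t + r) * y) := by
      refine (sum_nbij' (· + r) (· - r) ?_ ?_ ?_ ?_ ?_).symm
      · intro t ht
        simp only [fixedPts, mem_filter, mem_univ, true_and] at ht ⊢
        rw [hadd, ht, hr]
      · intro t ht
        simp only [fixedPts, mem_filter, mem_univ, true_and] at ht ⊢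
        rw [eq_sub_iff_add_eq]
        nth_rewrite 2 [← hr]
        rw [← hadd, sub_add_cancel, ht]
      · intro t _; simp
      · intro t _; simp
      · intro t _; rfl
    simp_rw [add_mul, AddChar.map_add_eq_mul, ← sum_mul] at hshift
    have : (∑ t ∈ fixedPts L q, ψ (t * y)) * (ψ (r * y) - 1) = 0 := by
      linear_combination -hshift
    exact (mul_eq_zero.1 this).resolve_right (sub_ne_zero.2 hr1)

/-- Averaging over nonzero subfield scalars replaces `ψ` by a test for trace zero. With `T` the sum
over `x ≠ 0` and `N` the number of roots, `(q-1) T = q (q-1) N - (q² - 1)`. -/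
theorem charWeilSum_eq {ψ : AddChar L ℂ} (hψ : ψ ≠ 1) (hψq : ∀ x, ψ (x ^ q) = ψ x)
    (hcard : Fintype.card L = q ^ 2) (hadd : ∀ x y : L, (x + y) ^ q = x ^ q + y ^ q)
    (hq : 1 < q) (h2 : (2 : L) ≠ 0) (j : ℕ) (a : L) :
    charWeilSum ψ (1 + (j + 1) * (q - 1)) a = q * ((nihoRoots q j a).card - 1) := by
  set s := 1 + (j + 1) * (q - 1) with hs
  have hs0 : s ≠ 0 := by omega
  set W := charWeilSum ψ s a with hW
  set T := ∑ x ∈ univ.erase (0 : L), ψ (x ^ s - a * x) with hT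
  have hWT : W = 1 + T := by
    rw [hW, charWeilSum, hT, ← add_sum_erase _ _ (mem_univ 0)]
    simp [zero_pow hs0]
  have hscale : ∀ r ∈ (fixedPts L q).erase 0,
      ∑ x ∈ univ.erase (0 : L), ψ (r * (x ^ s - a * x)) = T := by
    intro r hr
    simp only [fixedPts, mem_erase, mem_filter, mem_univ, true_and] at hr
    have hr1 : r ^ (q - 1) = 1 := by
      apply mul_right_cancel₀ hr.1
      rw [← pow_succ, show q - 1 + 1 = q by omega, hr.2, one_mul]
    have hrs : r ^ s = r := by rw [hs, pow_add, mul_comm (j + 1), pow_mul, hr1]; simp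
    refine sum_nbij' (r * ·) (r⁻¹ * ·) ?_ ?_ ?_ ?_ ?_
    · intro x hx; simpa [hr.1] using hx
    · intro x hx; simpa [hr.1] using hx
    · intro x _; simp [hr.1]
    · intro x _; simp [hr.1]
    · intro x _
      rw [mul_pow, hrs]; congr 1; ring
  have h1 : ∑ r ∈ (fixedPts L q).erase 0, ∑ x ∈ univ.erase (0 : L), ψ (r * (x ^ s - a * x)) =
      (q - 1) * T := by
    rw [sum_congr rfl hscale, sum_const, card_erase_of_mem, card_fixedPts hcard hq, nsmul_eq_mul,
      Nat.cast_sub hq.le, Nat.cast_one]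
    simp [fixedPts, zero_pow (show q ≠ 0 by omega)]
  have h3 : ∀ x : L, ∑ r ∈ (fixedPts L q).erase 0, ψ (r * (x ^ s - a * x)) =
      (if (x ^ s - a * x) + (x ^ s - a * x) ^ q = 0 then (q : ℂ) else 0) - 1 := by
    intro x
    rw [← sum_fixedPts_char hψ hψq hcard hadd hq h2, ← add_sum_erase (fixedPts L q) _ (a := 0)]
    · simp
    · simp [fixedPts, zero_pow (show q ≠ 0 by omega)]
  rw [sum_comm, sum_congr rfl fun x _ => h3 x, sum_sub_distrib, ← sum_filter, sum_const,
    sum_const, card_erase_of_mem (mem_univ _), card_univ, hcard] at h1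
  have h4 : (univ.erase (0 : L)).filter
      (fun x => (x ^ s - a * x) + (x ^ s - a * x) ^ q = 0) =
      univ.filter fun x => x ≠ 0 ∧ (x ^ s - a * x) + (x ^ s - a * x) ^ q = 0 := by
    ext x; simp
  rw [h4, hs, card_filter_trace_eq_zero hcard hadd hq, nsmul_eq_mul, nsmul_eq_mul,
    Nat.cast_mul, Nat.cast_sub hq.le, Nat.cast_sub (Nat.one_le_pow _ _ (by omega))] at h1
  push_cast at h1
  have hq1 : (q : ℂ) - 1 ≠ 0 := by
    rw [sub_ne_zero]; exact_mod_cast hq.ne'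
  rw [hWT]
  apply mul_left_cancel₀ hq1
  linear_combination -h1

end CharacterSums

/-! ### Counting roots of Niho's equation: at `a = 1`, over the subfield, and for the third moment
-/

section NihoRoots

variable {L : Type*} [Field L] [Fintype L] [DecidableEq L] {q : ℕ}

omit [Fintype L] [DecidableEq L] in
theorem niho_equation_one_iff (j : ℕ) (v : L) :
    v ^ (2 * j + 1) + 1 = v ^ j + v ^ (j + 1) ↔ v ^ (j + 1) = 1 ∨ v ^ j = 1 := by
  have h : v ^ (2 * j + 1) + 1 - (v ^ j + v ^ (j + 1)) = (v ^ (j + 1) - 1) * (v ^ j - 1) := by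
    ring
  rw [← sub_eq_zero, h, mul_eq_zero, sub_eq_zero, sub_eq_zero]

/-- The `m`-torsion of the unit circle. -/
def circleTorsion (L : Type*) [Field L] [Fintype L] [DecidableEq L] (q m : ℕ) : Finset L :=
  (unitCircle L q).filter fun v => v ^ m = 1

theorem card_circleTorsion (hcard : Fintype.card L = q ^ 2) (m : ℕ) :
    (circleTorsion L q m).card = m.gcd (q + 1) := by
  have hd : m.gcd (q + 1) ∣ Fintype.card L - 1 :=
    (Nat.gcd_dvd_right _ _).trans ⟨q - 1, by rw [hcard]; simpa using Nat.sq_sub_sq q 1⟩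
  refine Eq.trans (congrArg card ?_) (card_filter_pow_eq_one (L := L) hd)
  ext v
  simp only [circleTorsion, unitCircle, mem_filter, mem_univ, true_and, pow_gcd_eq_one, and_comm]

theorem card_nihoRoots_one (hcard : Fintype.card L = q ^ 2) (j : ℕ) :
    (nihoRoots q j (1 : L)).card + 1 = (j + 1).gcd (q + 1) + j.gcd (q + 1) := by
  have h1 : nihoRoots q j (1 : L) = circleTorsion L q (j + 1) ∪ circleTorsion L q j := by
    rw [circleTorsion, circleTorsion, ← filter_or]
    refine filter_congr fun v _ => ?_
    rw [one_pow, one_mul, one_mul, niho_equation_one_iff]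
  have h2 : circleTorsion L q (j + 1) ∩ circleTorsion L q j = {1} := by
    ext v
    simp only [circleTorsion, unitCircle, mem_inter, mem_filter, mem_univ, true_and, mem_singleton]
    constructor
    · rintro ⟨⟨-, h⟩, -, h'⟩
      rwa [pow_succ, h', one_mul] at h
    · rintro rfl
      simp
  rw [← card_circleTorsion hcard, ← card_circleTorsion hcard, ← card_union_add_card_inter, h1, h2,
    card_singleton]

theorem one_mem_circleTorsion (m : ℕ) : (1 : L) ∈ circleTorsion L q m := by
  simp [circleTorsion, unitCircle]

omit [DecidableEq L] in
theorem mem_circleTorsion_pair (hcard : Fintype.card L = q ^ 2)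
    (hadd : ∀ x y : L, (x + y) ^ q = x ^ q + y ^ q) (hq : 1 < q) (j : ℕ) {t v w : L}
    (ht : t ≠ 0) (ht1 : t + 1 ≠ 0) (hv : v = t ^ (q - 1)) (hw : w = (t + 1) ^ (q - 1))
    (h : t ^ (1 + (j + 1) * (q - 1)) + 1 = (t + 1) ^ (1 + (j + 1) * (q - 1))) :
    (v ^ (j + 1) = 1 ∧ w ^ (j + 1) = 1) ∨ (v ^ j = 1 ∧ w ^ j = 1) := by
  have hpow : ∀ x : L, x ^ q = x * x ^ (q - 1) := fun x => by
    rw [← pow_succ']; congr 1; omega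
  have hexp : ∀ x : L, x ^ (1 + (j + 1) * (q - 1)) = x * (x ^ (q - 1)) ^ (j + 1) := fun x => by
    rw [pow_add, mul_comm (j + 1), pow_mul, pow_one]
  have hinv : ∀ x : L, x ≠ 0 → (x ^ (q - 1)) ^ q * x ^ (q - 1) = 1 := fun x hx => by
    rw [← pow_succ]; exact pow_sub_one_pow_add_one hcard hx
  have hv1 := hinv t ht
  have hw1 := hinv (t + 1) ht1
  rw [hexp, hexp, ← hv, ← hw] at h
  rw [← hv] at hv1
  rw [← hw] at hw1
  have hv0 : v ≠ 0 := hv ▸ pow_ne_zero _ ht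
  have htv : t * v + 1 = (t + 1) * w := by
    rw [hv, hw, ← hpow, ← hpow, hadd, one_pow]
  have hconj : t * (v ^ q) ^ j + 1 = (t + 1) * (w ^ q) ^ j := by
    have h' := congrArg (· ^ q) h
    simp only [hadd, mul_pow, one_pow] at h'
    rw [pow_right_comm v, pow_right_comm w, hpow t, ← hv, htv,
      pow_succ, pow_succ] at h'
    linear_combination h' - t * (v ^ q) ^ j * hv1 + (t + 1) * (w ^ q) ^ j * hw1
  have hvj : (v ^ q) ^ j * v ^ j = 1 := by rw [← mul_pow, hv1, one_pow]
  have hwj : (w ^ q) ^ j * w ^ j = 1 := by rw [← mul_pow, hw1, one_pow]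
  -- Multiplying the equation by its conjugate eliminates `w`; what remains is Niho's equation at `a
  -- = 1` for `v`.
  have hprod : (t * v ^ (j + 1) + 1) * (t * (v ^ q) ^ j + 1) = (t + 1) * (t * v + 1) := by
    rw [h, hconj, htv, pow_succ]
    linear_combination (t + 1) ^ 2 * w * hwj
  have hroot : v ^ (2 * j + 1) + 1 = v ^ j + v ^ (j + 1) := by
    apply mul_left_cancel₀ ht
    have e : v ^ (2 * j + 1) = v ^ j * v ^ j * v := by ring
    rw [e]
    rw [pow_succ] at hprod ⊢
    linear_combination v ^ j * hprod - (t ^ 2 * v * v ^ j + t) * hvj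
  rcases (niho_equation_one_iff j v).1 hroot with hv' | hv'
  · refine Or.inl ⟨hv', mul_left_cancel₀ ht1 ?_⟩
    rw [← h, hv']
    ring
  · refine Or.inr ⟨hv', ?_⟩
    have hw0 : w ≠ 0 := hw ▸ pow_ne_zero _ ht1
    apply mul_left_cancel₀ (mul_ne_zero ht1 hw0)
    rw [pow_succ, pow_succ, hv', one_mul, htv] at h
    linear_combination -h

/-- A solution `t` outside the subfield is determined by `v = t^(q-1)` and `w = (t+1)^(q-1)`, which
are distinct, different from `1`, and both in the same torsion group. -/
theorem card_filter_add_one_le (hcard : Fintype.card L = q ^ 2)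
    (hadd : ∀ x y : L, (x + y) ^ q = x ^ q + y ^ q) (hq : 1 < q) (j : ℕ) :
    (univ.filter fun t : L => t ^ (1 + (j + 1) * (q - 1)) + 1 =
        (t + 1) ^ (1 + (j + 1) * (q - 1))).card ≤
      q + (((circleTorsion L q (j + 1)).erase 1).offDiag.card +
        ((circleTorsion L q j).erase 1).offDiag.card) := by
  -- Solves `t v + 1 = (t + 1) w`, the conjugate of `t + 1` computed twice, for `t`.
  set φ : L × L → L := fun x => (x.2 - 1) / (x.1 - x.2) with hφ
  have hsub : (univ.filter fun t : L => t ^ (1 + (j + 1) * (q - 1)) + 1 =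
      (t + 1) ^ (1 + (j + 1) * (q - 1))) ⊆ fixedPts L q ∪
        (((circleTorsion L q (j + 1)).erase 1).offDiag.image φ ∪
          ((circleTorsion L q j).erase 1).offDiag.image φ) := by
    intro t h
    simp only [mem_filter, mem_univ, true_and] at h
    rw [mem_union]
    by_cases hfix : t ^ q = t
    · exact Or.inl (by simpa [fixedPts] using hfix)
    right
    have hpow : ∀ x : L, x ^ q = x * x ^ (q - 1) := fun x => by
      rw [← pow_succ']; congr 1; omega
    have ht : t ≠ 0 := by
      rintro rfl
      exact hfix (zero_pow (by omega))
    have ht1 : t + 1 ≠ 0 := by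
      intro h0
      have := hadd t 1
      rw [h0, zero_pow (by omega), one_pow] at this
      exact hfix (add_right_cancel (this.symm.trans h0.symm))
    obtain ⟨v, hv⟩ : ∃ v, v = t ^ (q - 1) := ⟨_, rfl⟩
    obtain ⟨w, hw⟩ : ∃ w, w = (t + 1) ^ (q - 1) := ⟨_, rfl⟩
    have htv : t * v + 1 = (t + 1) * w := by
      rw [hv, hw, ← hpow, ← hpow, hadd, one_pow]
    have hv1 : v ≠ 1 := fun h1 => hfix (by rw [hpow, ← hv, h1, mul_one])
    have hw1 : w ≠ 1 := fun h1 => hv1 (mul_left_cancel₀ ht (by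
      rw [h1] at htv; linear_combination htv))
    have hvw : v ≠ w := fun h1 => hw1 (by rw [h1] at htv; linear_combination -htv)
    have hvU : v ^ (q + 1) = 1 := hv ▸ pow_sub_one_pow_add_one hcard ht
    have hwU : w ^ (q + 1) = 1 := hw ▸ pow_sub_one_pow_add_one hcard ht1
    have hφt : φ (v, w) = t := by
      rw [hφ]
      simp only
      rw [div_eq_iff (sub_ne_zero.2 hvw)]
      linear_combination -htv
    rw [mem_union, mem_image, mem_image]
    rcases mem_circleTorsion_pair hcard hadd hq j ht ht1 hv hw h with h | h
    · exact Or.inl ⟨(v, w), by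
        simp [circleTorsion, unitCircle, h, hvU, hwU, hv1, hw1, hvw], hφt⟩
    · exact Or.inr ⟨(v, w), by
        simp [circleTorsion, unitCircle, h, hvU, hwU, hv1, hw1, hvw], hφt⟩
  refine (card_le_card hsub).trans ((card_union_le _ _).trans ?_)
  rw [card_fixedPts hcard hq]
  gcongr
  refine (card_union_le _ _).trans ?_
  gcongr <;> exact card_image_le

theorem mem_nihoRoots_fixedPts {j : ℕ} {a v : L} (ha : a ∈ fixedPts L q) :
    v ∈ nihoRoots q j a ↔
      v ^ (q + 1) = 1 ∧ v ^ (2 * j + 1) + 1 = a * (v ^ j + v ^ (j + 1)) := by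
  simp only [fixedPts, mem_filter, mem_univ, true_and] at ha
  simp only [nihoRoots, unitCircle, mem_filter, mem_univ, true_and, ha, mul_add]

omit [Fintype L] [DecidableEq L] in
theorem neg_one_niho (j : ℕ) (a : L) :
    (-1 : L) ^ (2 * j + 1) + 1 = a * ((-1) ^ j + (-1) ^ (j + 1)) := by
  rw [pow_succ, pow_succ, pow_mul]; simp

theorem even_card_nihoRoots_sdiff (j : ℕ) {a : L} (ha : a ∈ fixedPts L q) :
    Even (((nihoRoots q j a).erase (-1)).erase 1).card := by
  rw [← ZMod.natCast_eq_zero_iff_even, cast_card]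
  refine sum_involution (fun v _ => v⁻¹) (fun _ _ => by decide) ?_ ?_ (fun v _ => inv_inv v)
  · intro v hv _ h
    simp only [mem_erase, mem_nihoRoots_fixedPts ha] at hv
    have hv0 : v ≠ 0 := by rintro rfl; simp at hv
    have : v * v = 1 := by nth_rewrite 1 [← h]; exact inv_mul_cancel₀ hv0
    rcases mul_self_eq_one_iff.1 this with h | h
    · exact hv.1 h
    · exact hv.2.1 h
  · intro v hv
    simp only [mem_erase, mem_nihoRoots_fixedPts ha] at hv ⊢
    have hv0 : v ≠ 0 := by rintro rfl; simp at hv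
    refine ⟨by simpa using hv.1, fun h => hv.2.1 ?_, by rw [inv_pow, hv.2.2.1, inv_one], ?_⟩
    · rw [← inv_inv v, h, inv_neg_one]
    · apply mul_right_cancel₀ (pow_ne_zero (2 * j + 1) hv0)
      have e : v⁻¹ * v = 1 := inv_mul_cancel₀ hv0
      have e1 : v⁻¹ ^ (2 * j + 1) * v ^ (2 * j + 1) = 1 := by rw [← mul_pow, e, one_pow]
      have e2 : v⁻¹ ^ j * v ^ j = 1 := by rw [← mul_pow, e, one_pow]
      have e3 : v⁻¹ ^ (j + 1) * v ^ (j + 1) = 1 := by rw [← mul_pow, e, one_pow]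
      have h := hv.2.2.2
      have f1 : v ^ (2 * j + 1) = v ^ j * v ^ (j + 1) := by ring
      rw [f1] at e1 h ⊢
      linear_combination h + e1 - a * v ^ (j + 1) * e2 - a * v ^ j * e3

theorem odd_card_nihoRoots (hq : Odd q) (h2 : (2 : L) ≠ 0) (j : ℕ) {a : L}
    (ha : a ∈ fixedPts L q) (ha1 : a ≠ 1) : Odd (nihoRoots q j a).card := by
  have h := even_card_nihoRoots_sdiff j ha
  have hm : (-1 : L) ∈ nihoRoots q j a :=
    (mem_nihoRoots_fixedPts ha).2 ⟨(hq.add_one).neg_one_pow, neg_one_niho j a⟩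
  have h1 : (1 : L) ∉ (nihoRoots q j a).erase (-1) := by
    intro h
    have := ((mem_nihoRoots_fixedPts ha).1 (mem_of_mem_erase h)).2
    simp only [one_pow, one_add_one_eq_two] at this
    exact ha1 (mul_right_cancel₀ h2 (by rw [← this, one_mul]))
  rw [erase_eq_of_notMem h1] at h
  rw [← card_erase_add_one hm]
  exact h.add_one

theorem even_card_nihoRoots_one (hq : Odd q) (h2 : (2 : L) ≠ 0) (j : ℕ) :
    Even (nihoRoots q j (1 : L)).card := by
  have ha : (1 : L) ∈ fixedPts L q := by simp [fixedPts]
  have h := even_card_nihoRoots_sdiff j ha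
  have hm : (-1 : L) ∈ nihoRoots q j (1 : L) :=
    (mem_nihoRoots_fixedPts ha).2 ⟨(hq.add_one).neg_one_pow, neg_one_niho j 1⟩
  have h1 : (1 : L) ∈ (nihoRoots q j (1 : L)).erase (-1) := by
    refine mem_erase.2 ⟨fun h => h2 ?_, (mem_nihoRoots_fixedPts ha).2 (by simp)⟩
    rw [← one_add_one_eq_two]
    nth_rewrite 1 [h]
    simp
  rw [← card_erase_add_one hm, ← card_erase_add_one h1]
  exact h.add_one.add_one

/-- Double counting: `-1` is a root for all `q` subfield points, and each of the other `q` norm-one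
elements is a root for exactly one. -/
theorem sum_card_nihoRoots_fixedPts (hcard : Fintype.card L = q ^ 2) (hq : Odd q) (hq1 : 1 < q)
    (hadd : ∀ x y : L, (x + y) ^ q = x ^ q + y ^ q) (j : ℕ) :
    ∑ a ∈ fixedPts L q, (nihoRoots q j a).card = 2 * q := by
  have h1 : ∀ a ∈ fixedPts L q, (nihoRoots q j a).card = ∑ v ∈ unitCircle L q,
      if v ^ (2 * j + 1) + 1 = a * (v ^ j + v ^ (j + 1)) then 1 else 0 := by
    intro a ha
    rw [← card_filter]
    congr 1
    ext v
    rw [mem_nihoRoots_fixedPts ha]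
    simp [unitCircle]
  have hm : (-1 : L) ∈ unitCircle L q := by simp [unitCircle, (hq.add_one).neg_one_pow]
  rw [sum_congr rfl h1, sum_comm, ← add_sum_erase _ _ hm]
  have h2 : ∀ v ∈ (unitCircle L q).erase (-1), (∑ a ∈ fixedPts L q,
      if v ^ (2 * j + 1) + 1 = a * (v ^ j + v ^ (j + 1)) then 1 else 0) = 1 := by
    intro v hv
    simp only [mem_erase, unitCircle, mem_filter, mem_univ, true_and] at hv
    obtain ⟨hv1, hv⟩ := hv
    have hv0 : v ≠ 0 := by rintro rfl; simp at hv
    have hd : v ^ j + v ^ (j + 1) ≠ 0 := by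
      have : v ^ j + v ^ (j + 1) = v ^ j * (v + 1) := by ring
      rw [this]
      exact mul_ne_zero (pow_ne_zero _ hv0) fun h => hv1 (eq_neg_of_add_eq_zero_left h)
    rw [← card_filter, card_eq_one]
    refine ⟨(v ^ (2 * j + 1) + 1) / (v ^ j + v ^ (j + 1)), ?_⟩
    ext a
    simp only [mem_filter, mem_singleton, eq_div_iff hd, eq_comm (a := a * _)]
    refine and_iff_right_of_imp fun h => ?_
    replace h := (eq_div_iff hd).2 h.symm
    simp only [fixedPts, mem_filter, mem_univ, true_and]
    have hvq : v ^ q * v = 1 := by rw [← pow_succ, hv]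
    have e : ∀ i, (v ^ i) ^ q * v ^ i = 1 := fun i => by
      rw [pow_right_comm, ← mul_pow, hvq, one_pow]
    have hdq : (v ^ j + v ^ (j + 1)) ^ q * v ^ (2 * j + 1) = v ^ j + v ^ (j + 1) := by
      rw [hadd, show v ^ (2 * j + 1) = v ^ j * v ^ (j + 1) by ring]
      linear_combination v ^ (j + 1) * e j + v ^ j * e (j + 1)
    have hnq : (v ^ (2 * j + 1) + 1) ^ q * v ^ (2 * j + 1) = v ^ (2 * j + 1) + 1 := by
      rw [hadd, one_pow]
      linear_combination e (2 * j + 1)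
    rw [h, div_pow, ← mul_div_mul_right _ _ (pow_ne_zero (2 * j + 1) hv0), hdq, hnq]
  rw [sum_congr rfl h2, sum_const, card_erase_of_mem hm, card_unitCircle hcard]
  rw [sum_congr rfl fun a _ => if_pos (neg_one_niho j a), sum_const, card_fixedPts hcard hq1]
  simp [two_mul]

end NihoRoots

/-! ### Integer functions with prescribed moments -/

section IntegerMoments

variable {ι : Type*} [Fintype ι]

/-- The cubic vanishes at every permitted value except possibly `b`. -/
theorem sum_cubic_eq (M : ι → ℤ) (a b : ℤ)
    (hM : ∀ i, M i = -1 ∨ M i = 0 ∨ M i = a ∨ M i = b) :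
    ∑ i, M i * (M i + 1) * (M i - a) =
      b * (b + 1) * (b - a) * (univ.filter fun i => M i = b).card := by
  rw [card_filter]
  push_cast
  rw [mul_sum]
  refine sum_congr rfl fun i _ => ?_
  split_ifs with h
  · rw [h, mul_one]
  · rcases hM i with h' | h' | h' | h' <;> simp_all

theorem sum_cubic_of_moments (M : ι → ℤ) (q C a : ℤ) (h1 : ∑ i, M i = q)
    (h2 : ∑ i, M i ^ 2 = q ^ 2) (h3 : ∑ i, M i ^ 3 = q * (q + C)) :
    ∑ i, M i * (M i + 1) * (M i - a) = q * (q * (2 - a) + C - a) := by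
  have : ∀ i, M i * (M i + 1) * (M i - a) = M i ^ 3 + (1 - a) * M i ^ 2 - a * M i :=
    fun i => by ring
  simp_rw [this, sum_sub_distrib, sum_add_distrib, ← mul_sum, h1, h2, h3]
  ring

/-- An integer function with the first three moments of a Niho spectrum does not take only
four values `-1`, `0`, `A`, `B`. -/
theorem exists_value_notMem (M : ι → ℤ) (q C A B : ℤ) (h1 : ∑ i, M i = q)
    (h2 : ∑ i, M i ^ 2 = q ^ 2) (h3 : ∑ i, M i ^ 3 = q * (q + C)) (hA : Even A) (hA2 : 2 ≤ A)
    (hB : Odd B) (hB3 : 3 ≤ B) (hCB : C ≤ B ^ 2 - B) (hCq : C < q) (hq : 0 < q)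
    (hcop : IsCoprime (B * (B + 1) * (B - 2)) q)
    (hiA : ∃ i, M i = A) (hiB : ∃ i, M i = B) :
    ∃ i, M i ≠ -1 ∧ M i ≠ 0 ∧ M i ≠ A ∧ M i ≠ B := by
  by_contra! hcon
  have hM : ∀ i, M i = -1 ∨ M i = 0 ∨ M i = A ∨ M i = B := fun i => by
    have := hcon i
    tauto
  have hAB : A ≠ B := by
    rintro rfl
    exact Int.not_even_iff_odd.2 hB hA
  have eB := (sum_cubic_eq M A B hM).symm.trans (sum_cubic_of_moments M q C A h1 h2 h3)
  have eA := (sum_cubic_eq M B A fun i => by have := hM i; tauto).symm.trans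
    (sum_cubic_of_moments M q C B h1 h2 h3)
  have pos : ∀ c, (∃ i, M i = c) → 0 < ((univ.filter fun i => M i = c).card : ℤ) := by
    rintro c ⟨i, hi⟩
    exact_mod_cast card_pos.2 ⟨i, by simpa using hi⟩
  have zB := pos B hiB
  have zA := pos A hiA
  set y : ℤ := ((univ.filter fun i => M i = A).card : ℤ)
  set z : ℤ := ((univ.filter fun i => M i = B).card : ℤ)
  have hBB : 0 < B * (B + 1) := by positivity
  have hAA : 0 < A * (A + 1) := by positivity
  rcases hA2.eq_or_lt with rfl | hA2
  · have e : B * (B + 1) * (B - 2) * z = q * (C - 2) := by linear_combination eB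
    have hdvd : B * (B + 1) * (B - 2) ∣ C - 2 := hcop.dvd_of_dvd_mul_left ⟨z, e.symm⟩
    have hpos : 0 < B * (B + 1) * (B - 2) := mul_pos hBB (by linarith)
    have hC : 0 < C - 2 := pos_of_mul_pos_right (e ▸ mul_pos hpos zB) hq.le
    have hle := Int.le_of_dvd hC hdvd
    -- `C - 2 ≤ B² - B - 2 = (B+1)(B-2)`, which is less than `B(B+1)(B-2)`.
    have : 0 < (B - 1) * ((B + 1) * (B - 2)) :=
      mul_pos (by linarith) (mul_pos (by linarith) (by linarith))
    linarith
  · have hA4 : 4 ≤ A := by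
      obtain ⟨c, rfl⟩ := hA
      omega
    have nB : q * (q * (2 - A) + C - A) < 0 :=
      mul_neg_of_pos_of_neg hq (by nlinarith)
    have nA : q * (q * (2 - B) + C - B) < 0 :=
      mul_neg_of_pos_of_neg hq (by nlinarith)
    rw [← eB] at nB
    rw [← eA] at nA
    rcases lt_or_gt_of_ne hAB with h | h
    · exact absurd nB (not_lt.2 (mul_pos (mul_pos hBB (by linarith)) zB).le)
    · exact absurd nA (not_lt.2 (mul_pos (mul_pos hAA (by linarith)) zA).le)

/-- If `M ≥ 0` then `M ≤ q`, and `∑ M (q - M) = 0` leaves only the values `0` and `q`. -/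
theorem exists_neg_of_moments (M : ι → ℤ) (q : ℤ) (h1 : ∑ i, M i = q)
    (h2 : ∑ i, M i ^ 2 = q ^ 2) (hi : ∃ i, 0 < M i ∧ M i < q) : ∃ i, M i < 0 := by
  by_contra! hcon
  have hle : ∀ i, M i ≤ q := fun i => h1 ▸ single_le_sum (fun j _ => hcon j) (mem_univ i)
  have h0 : ∑ i, M i * (q - M i) = 0 := by
    have : ∀ i, M i * (q - M i) = q * M i - M i ^ 2 := fun i => by ring
    simp_rw [this, sum_sub_distrib, ← mul_sum, h1, h2]
    ring
  obtain ⟨i, hi0, hiq⟩ := hi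
  have := (sum_eq_zero_iff_of_nonneg fun j _ =>
    mul_nonneg (hcon j) (sub_nonneg.2 (hle j))).1 h0 i (mem_univ i)
  exact (mul_pos hi0 (sub_pos.2 hiq)).ne' this

end IntegerMoments

/-! ### The canonical character: nontrivial and Frobenius-invariant -/

section CanonicalCharacter

/-- The canonical additive character of a finite field as an `AddChar`. -/
noncomputable def canonicalAddChar (p : ℕ) [NeZero p] (K : Type*) [Field K]
    [Algebra (ZMod p) K] : AddChar K ℂ :=
  (ZMod.stdAddChar (N := p)).compAddMonoidHom (Algebra.trace (ZMod p) K).toAddMonoidHom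

theorem canonicalAddChar_apply (p : ℕ) [NeZero p] (K : Type*) [Field K] [Algebra (ZMod p) K]
    (x : K) : canonicalAddChar p K x = canonicalChar p K x := by
  simp only [canonicalAddChar, AddChar.compAddMonoidHom_apply, ZMod.stdAddChar_apply,
    ZMod.toCircle_apply, canonicalChar]
  rfl

theorem weilSum_eq_charWeilSum (p : ℕ) [NeZero p] (K : Type*) [Field K] [Fintype K]
    [Algebra (ZMod p) K] (s : ℕ) (a : K) :
    weilSum p K s a = charWeilSum (canonicalAddChar p K) s a := by
  simp only [weilSum, charWeilSum, canonicalAddChar_apply]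

theorem canonicalAddChar_ne_one (p : ℕ) [Fact p.Prime] (K : Type*) [Field K] [Finite K]
    [Algebra (ZMod p) K] : canonicalAddChar p K ≠ 1 := by
  intro h
  refine Algebra.trace_ne_zero (ZMod p) K (LinearMap.ext fun x => ?_)
  have hx : canonicalAddChar p K x = 1 := by rw [h]; rfl
  rw [canonicalAddChar, AddChar.compAddMonoidHom_apply,
    ← (ZMod.stdAddChar (N := p)).map_zero_eq_one] at hx
  exact ZMod.injective_stdAddChar hx

theorem canonicalAddChar_pow (p n : ℕ) [Fact p.Prime] (K : Type*) [Field K] [Finite K]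
    [Algebra (ZMod p) K] (x : K) : canonicalAddChar p K (x ^ p ^ n) = canonicalAddChar p K x := by
  induction n with
  | zero => simp
  | succ n ih =>
    rw [pow_succ, pow_mul, ← ih]
    have h := Algebra.trace_eq_of_algEquiv
      (FiniteField.frobeniusAlgEquivOfAlgebraic (ZMod p) K) (x ^ p ^ n)
    rw [FiniteField.coe_frobeniusAlgEquivOfAlgebraic, ZMod.card] at h
    simp only [canonicalAddChar, AddChar.compAddMonoidHom_apply]
    exact congrArg _ h

end CanonicalCharacter

/-! ### Values and moments of the normalized Weil sum -/

section NihoSpectrum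

variable {L : Type*} [Field L] [Fintype L] [DecidableEq L] {q : ℕ}

/-- The normalized Niho sum `W(a) / q`, an integer. -/
def nihoValue (q j : ℕ) (a : L) : ℤ := (nihoRoots q j a).card - 1

theorem nihoValue_zero {ψ : AddChar L ℂ} (hψ : ψ ≠ 1) (hψq : ∀ x, ψ (x ^ q) = ψ x)
    (hcard : Fintype.card L = q ^ 2) (hadd : ∀ x y : L, (x + y) ^ q = x ^ q + y ^ q)
    (hq : 1 < q) (h2 : (2 : L) ≠ 0) (j : ℕ)
    (hs : (1 + (j + 1) * (q - 1)).Coprime (Fintype.card L - 1)) :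
    nihoValue q j (0 : L) = 0 := by
  have h := charWeilSum_eq hψ hψq hcard hadd hq h2 j 0
  simp only [charWeilSum, zero_mul, sub_zero] at h
  rw [(pow_bijective_of_coprime (by omega) hs).sum_comp (fun x => ψ x),
    AddChar.sum_eq_zero_of_ne_one hψ] at h
  have hq0 : (q : ℂ) ≠ 0 := Nat.cast_ne_zero.2 (by omega)
  have h' := (mul_eq_zero.1 h.symm).resolve_left hq0
  rw [nihoValue]
  exact_mod_cast h'

theorem nihoValue_moments {ψ : AddChar L ℂ} (hψ : ψ ≠ 1) (hψq : ∀ x, ψ (x ^ q) = ψ x)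
    (hcard : Fintype.card L = q ^ 2) (hadd : ∀ x y : L, (x + y) ^ q = x ^ q + y ^ q)
    (hq : 1 < q) (h2 : (2 : L) ≠ 0) (j : ℕ) (hodd : Odd (1 + (j + 1) * (q - 1)))
    (hs : (1 + (j + 1) * (q - 1)).Coprime (Fintype.card L - 1)) :
    ∑ a : L, nihoValue q j a = q ∧ ∑ a : L, nihoValue q j a ^ 2 = q ^ 2 ∧
      ∑ a : L, nihoValue q j a ^ 3 = q * (univ.filter fun t : L =>
        t ^ (1 + (j + 1) * (q - 1)) + 1 = (t + 1) ^ (1 + (j + 1) * (q - 1))).card := by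
  have hprim := AddChar.IsPrimitive.of_ne_one hψ
  have hW : ∀ a : L, charWeilSum ψ (1 + (j + 1) * (q - 1)) a = q * (nihoValue q j a : ℂ) :=
    fun a => by
      rw [charWeilSum_eq hψ hψq hcard hadd hq h2, nihoValue]
      push_cast
      rfl
  have m1 := sum_charWeilSum hprim (s := 1 + (j + 1) * (q - 1)) (by omega)
  have m2 := sum_charWeilSum_sq hprim hodd
  have m3 := sum_charWeilSum_cube hprim hodd
  rw [sum_sum_char_homogeneous hprim (by omega) hs] at m3
  simp_rw [hW, mul_pow, ← mul_sum, hcard] at m1 m2 m3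
  have hq0 : (q : ℂ) ≠ 0 := Nat.cast_ne_zero.2 (by omega)
  refine ⟨?_, ?_, ?_⟩
  · have : (∑ a : L, (nihoValue q j a : ℂ)) = q := by
      apply mul_left_cancel₀ hq0
      rw [m1]; push_cast; ring
    exact_mod_cast this
  · have : (∑ a : L, (nihoValue q j a : ℂ) ^ 2) = (q : ℂ) ^ 2 := by
      apply mul_left_cancel₀ (pow_ne_zero 2 hq0)
      rw [m2]; push_cast; ring
    exact_mod_cast this
  · have : (∑ a : L, (nihoValue q j a : ℂ) ^ 3) = q * ((univ.filter fun t : L =>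
        t ^ (1 + (j + 1) * (q - 1)) + 1 = (t + 1) ^ (1 + (j + 1) * (q - 1))).card : ℕ) := by
      apply mul_left_cancel₀ (pow_ne_zero 3 hq0)
      rw [m3]; push_cast; ring
    exact_mod_cast this

theorem sum_nihoValue_fixedPts (hcard : Fintype.card L = q ^ 2) (hq : Odd q) (hq1 : 1 < q)
    (hadd : ∀ x y : L, (x + y) ^ q = x ^ q + y ^ q) (j : ℕ) :
    ∑ a ∈ fixedPts L q, nihoValue q j a = q := by
  simp only [nihoValue]
  rw [sum_sub_distrib, ← Nat.cast_sum, sum_card_nihoRoots_fixedPts hcard hq hq1 hadd]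
  simp [card_fixedPts hcard hq1, two_mul]

theorem even_nihoValue (hq : Odd q) (h2 : (2 : L) ≠ 0) (j : ℕ) {a : L}
    (ha : a ∈ fixedPts L q) (ha1 : a ≠ 1) : Even (nihoValue q j a) ∧ 0 ≤ nihoValue q j a := by
  obtain ⟨c, hc⟩ := odd_card_nihoRoots hq h2 j ha ha1
  rw [nihoValue, hc]
  push_cast
  exact ⟨⟨c, by ring⟩, by omega⟩

/-- On the subfield of order `q` there are points with a positive even value. -/
theorem exists_even_nihoValue (hcard : Fintype.card L = q ^ 2) (hq : Odd q) (hq1 : 1 < q)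
    (hadd : ∀ x y : L, (x + y) ^ q = x ^ q + y ^ q) (h2 : (2 : L) ≠ 0) (j : ℕ)
    (h1 : nihoValue q j (1 : L) < q) :
    ∃ a : L, Even (nihoValue q j a) ∧ 2 ≤ nihoValue q j a := by
  have h1m : (1 : L) ∈ fixedPts L q := by simp [fixedPts]
  by_contra! hcon
  have h := sum_nihoValue_fixedPts hcard hq hq1 hadd j
  rw [← add_sum_erase _ _ h1m, sum_eq_zero] at h
  · omega
  · intro a ha
    obtain ⟨he, h0⟩ := even_nihoValue hq h2 j (mem_of_mem_erase ha) (ne_of_mem_erase ha)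
    have := hcon a he
    obtain ⟨c, hc⟩ := he
    omega

/-- On the subfield of order `q` there is a nonzero point with value zero. -/
theorem exists_ne_zero_nihoValue_eq_zero (hcard : Fintype.card L = q ^ 2) (hq : Odd q)
    (hq1 : 3 ≤ q) (hadd : ∀ x y : L, (x + y) ^ q = x ^ q + y ^ q) (h2 : (2 : L) ≠ 0) (j : ℕ)
    (h0 : nihoValue q j (0 : L) = 0) (h1 : 2 ≤ nihoValue q j (1 : L)) :
    ∃ a : L, a ≠ 0 ∧ nihoValue q j a = 0 := by
  have h1m : (1 : L) ∈ fixedPts L q := by simp [fixedPts]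
  have h0m : (0 : L) ∈ (fixedPts L q).erase 1 := by
    simp [fixedPts, zero_pow (show q ≠ 0 by omega)]
  by_contra! hcon
  have h := sum_nihoValue_fixedPts hcard hq (by omega) hadd j
  rw [← add_sum_erase _ _ h1m, ← add_sum_erase _ _ h0m, h0, zero_add] at h
  -- Otherwise the `q - 2` points other than `0, 1` contribute at least `2` each, and the total is
  -- at least `2 + 2(q-2) > q`.
  have hle := card_nsmul_le_sum (((fixedPts L q).erase 1).erase 0) (nihoValue q j) 2 fun a ha => by
    have ha' := mem_of_mem_erase ha
    obtain ⟨⟨c, hc⟩, hn⟩ := even_nihoValue hq h2 j (mem_of_mem_erase ha') (ne_of_mem_erase ha')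
    have := hcon a (ne_of_mem_erase ha)
    omega
  rw [card_erase_of_mem h0m, card_erase_of_mem h1m, card_fixedPts hcard (by omega),
    nsmul_eq_mul] at hle
  have : ((q - 1 - 1 : ℕ) : ℤ) = q - 2 := by omega
  rw [this] at hle
  linarith

end NihoSpectrum

/-! ### Assembling the spectrum -/

theorem List.Nodup.length_le_ncard {α : Type*} {S : Set α} (hS : S.Finite) {l : List α}
    (hl : l.Nodup) (h : ∀ x ∈ l, x ∈ S) : l.length ≤ S.ncard := by
  classical
  rw [← List.toFinset_card_of_nodup hl, ← Set.ncard_coe_finset]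
  exact Set.ncard_le_ncard (fun x hx => h x (by simpa using hx)) hS

theorem isCoprime_prime_pow {p b : ℕ} (hp : p.Prime) (n : ℕ) (hb : b + 4 < p) :
    IsCoprime (((b : ℤ) + 3) * ((b : ℤ) + 3 + 1) * ((b : ℤ) + 3 - 2)) ((p ^ n : ℕ) : ℤ) := by
  have h : ((b : ℤ) + 3) * ((b : ℤ) + 3 + 1) * ((b : ℤ) + 3 - 2) =
      (((b + 3) * (b + 4) * (b + 1) : ℕ) : ℤ) := by push_cast; ring
  have hlt : ∀ m, m + 1 < p → (m + 1).Coprime p := fun m hm =>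
    ((Nat.coprime_of_lt_prime (Nat.succ_ne_zero m) hm hp)).symm
  rw [h, Nat.isCoprime_iff_coprime]
  exact (((hlt (b + 2) (by omega)).mul_left (hlt (b + 3) (by omega))).mul_left
    (hlt b (by omega))).pow_right n

theorem mainTheorem2 (p n k s d₁ d₂ : ℕ) (hp : p.Prime) (hp_odd : Odd p) (hn : 2 ≤ n)
    {F L : Type*} [Field F] [Field L] [Fintype L] [Algebra F L] [Algebra (ZMod p) L]
    (hF : Nat.card F = p ^ n) (hL : Module.finrank F L = 2)
    (hk : 2 ≤ k) (hkp : (k : ℝ) < (p : ℝ) / 2 + 1)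
    (hs : s = 1 + k * (p ^ n - 1))
    (hinv : IsInvertibleExponent L s) (hniho : IsNihoExponent p n s)
    (hd₁ : d₁ = Nat.gcd k (p ^ n + 1)) (hd₂ : d₂ = Nat.gcd (k - 1) (p ^ n + 1))
    (hd : 5 ≤ d₁ + d₂) :
    5 ≤ (weilSpectrum p L s).ncard ∧
      ∃ α β : ℕ, 1 ≤ α ∧ 1 ≤ β ∧
        ({0, -(p : ℂ) ^ n, 2 * (α : ℂ) * (p : ℂ) ^ n, (2 * (β : ℂ) + 1) * (p : ℂ) ^ n} : Set ℂ) ⊆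
          weilSpectrum p L s := by
  classical
  have : Fact p.Prime := ⟨hp⟩
  have : CharP L p := charP_of_injective_algebraMap' (ZMod p) p
  obtain ⟨j, rfl⟩ : ∃ j, k = j + 1 := ⟨k - 1, by omega⟩
  rw [Nat.add_sub_cancel] at hd₂
  have hp3 : 3 ≤ p := by
    have := hp.two_le
    obtain ⟨c, hc⟩ := hp_odd
    omega
  have hjp : 2 * j < p := by
    push_cast at hkp
    have : ((2 * j : ℕ) : ℝ) < p := by push_cast; linarith
    exact_mod_cast this
  have hpq : p ^ 2 ≤ p ^ n := Nat.pow_le_pow_right hp.pos hn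
  have hqodd : Odd (p ^ n) := hp_odd.pow
  have hcpow : (p : ℂ) ^ n = ((p ^ n : ℕ) : ℂ) := by push_cast; rfl
  have hψq : ∀ x : L, canonicalAddChar p L (x ^ p ^ n) = canonicalAddChar p L x :=
    canonicalAddChar_pow p n L
  have hadd : ∀ x y : L, (x + y) ^ p ^ n = x ^ p ^ n + y ^ p ^ n :=
    fun x y => add_pow_char_pow x y p n
  have hcard : Fintype.card L = (p ^ n) ^ 2 := by
    have : Finite F := Finite.of_injective _ (algebraMap F L).injective
    rw [← Nat.card_eq_fintype_card, Module.natCard_eq_pow_finrank (K := F), hF, hL]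
  have h2 : (2 : L) ≠ 0 := Ring.two_ne_zero (by rw [ringChar.eq L p]; omega)
  have hd₁k : d₁ ≤ j + 1 := hd₁ ▸ Nat.gcd_le_left _ (by omega)
  have hd₂k : d₂ ≤ j := hd₂ ▸ Nat.gcd_le_left _ (by omega)
  have hd₁0 : 0 < d₁ := hd₁ ▸ Nat.gcd_pos_of_pos_left _ (by omega)
  have hd₂0 : 0 < d₂ := hd₂ ▸ Nat.gcd_pos_of_pos_left _ (by omega)
  -- Thus `B = b + 3`, and `B + 1 = d₁ + d₂ - 1 ≤ 2j < p`; this is where the bound on `k` enters.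
  obtain ⟨b, hb⟩ : ∃ b, d₁ + d₂ = b + 5 := ⟨d₁ + d₂ - 5, by omega⟩
  have hcop := isCoprime_prime_pow hp n (b := b) (by omega)
  -- `n ≥ 2` turns `B < p` into `B² < q`, which later gives `C < q`.
  have hbp : (b + 3) ^ 2 < p ^ n :=
    (Nat.pow_lt_pow_left (by omega : b + 3 < p) two_ne_zero).trans_le hpq
  rw [hcpow]
  generalize p ^ n = q at *
  subst hs
  have hq3 : 3 ≤ q := by
    have := Nat.le_self_pow two_ne_zero (b + 3)
    omega
  have hq1 : 1 < q := by omega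
  have hψ := canonicalAddChar_ne_one p L
  have hinv' : (1 + (j + 1) * (q - 1)).Coprime (Fintype.card L - 1) := by
    rw [← Nat.card_eq_fintype_card]; exact hinv
  have hodd : Odd (1 + (j + 1) * (q - 1)) := by
    obtain ⟨c, rfl⟩ := hqodd
    exact ⟨(j + 1) * c, by rw [Nat.add_sub_cancel]; ring⟩
  have hM0 : nihoValue q j (0 : L) = 0 :=
    nihoValue_zero hψ hψq hcard hadd hq1 h2 j hinv'
  obtain ⟨m1, m2, m3⟩ := nihoValue_moments hψ hψq hcard hadd hq1 h2 j hodd hinv'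
  have hV := card_filter_add_one_le hcard hadd hq1 j
  set V := (univ.filter fun t : L =>
    t ^ (1 + (j + 1) * (q - 1)) + 1 = (t + 1) ^ (1 + (j + 1) * (q - 1))).card
  rw [offDiag_card, offDiag_card, card_erase_of_mem (one_mem_circleTorsion _),
    card_erase_of_mem (one_mem_circleTorsion _), card_circleTorsion hcard,
    card_circleTorsion hcard, ← hd₁, ← hd₂] at hV
  have hM1 : nihoValue q j (1 : L) = b + 3 := by
    have := card_nihoRoots_one hcard j
    rw [← hd₁, ← hd₂] at this
    rw [nihoValue]
    omega
  have hBodd : Odd ((b : ℤ) + 3) := by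
    obtain ⟨c, hc⟩ := even_card_nihoRoots_one hqodd h2 j
    rw [← hM1, nihoValue, hc]
    exact ⟨c - 1, by push_cast; ring⟩
  have hCB : (V : ℤ) - q ≤ ((b : ℤ) + 3) ^ 2 - (b + 3) := by
    obtain ⟨c₁, rfl⟩ : ∃ c, d₁ = c + 1 := ⟨d₁ - 1, by omega⟩
    obtain ⟨c₂, rfl⟩ : ∃ c, d₂ = c + 1 := ⟨d₂ - 1, by omega⟩
    simp only [Nat.add_sub_cancel] at hV
    zify [Nat.le_mul_self c₁, Nat.le_mul_self c₂] at hV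
    have : (b : ℤ) + 3 = c₁ + c₂ := by omega
    rw [this]
    -- The cross term `2 c₁ c₂` is what `c₁² - c₁ + c₂² - c₂` lacks compared with `B² - B`, where `B
    -- = c₁ + c₂`.
    have h0 := mul_nonneg (Int.natCast_nonneg c₁) (Int.natCast_nonneg c₂)
    rw [add_sq]
    linarith
  have hbq : ((b : ℤ) + 3) ^ 2 < q := by exact_mod_cast hbp
  have hBq : (b : ℤ) + 3 < q := (le_self_pow₀ (by omega) two_ne_zero).trans_lt hbq
  obtain ⟨x, hxe, hx2⟩ := exists_even_nihoValue hcard hqodd hq1 hadd h2 j (by rw [hM1]; exact hBq)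
  obtain ⟨y, hy0, hy⟩ := exists_ne_zero_nihoValue_eq_zero hcard hqodd hq3 hadd h2 j hM0
    (by rw [hM1]; omega)
  obtain ⟨z, hz⟩ := exists_neg_of_moments (nihoValue q j (L := L)) q m1 m2
    ⟨1, by rw [hM1]; omega, by rw [hM1]; exact hBq⟩
  replace hz : nihoValue q j z = -1 := by
    rw [nihoValue] at hz ⊢
    omega
  obtain ⟨w, hw1, hw0, hwA, hwB⟩ := exists_value_notMem (nihoValue q j (L := L)) q (V - q)
    (nihoValue q j x) (b + 3) m1 m2 (by rw [m3]; ring) hxe hx2 hBodd (by omega) hCB (by omega)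
    (by omega) hcop ⟨x, rfl⟩ ⟨1, hM1⟩
  have hmem : ∀ a : L, a ≠ 0 → ((nihoValue q j a : ℤ) : ℂ) * q ∈
      weilSpectrum p L (1 + (j + 1) * (q - 1)) := fun a ha => ⟨a, ha, by
    rw [weilSum_eq_charWeilSum, charWeilSum_eq hψ hψq hcard hadd hq1 h2, nihoValue, mul_comm]
    push_cast
    rfl⟩
  -- The moments run over all of `L`, but `a = 0` contributes only the value `0`, so nonzero values
  -- do lie in the spectrum.
  have hne : ∀ a : L, nihoValue q j a ≠ 0 → a ≠ 0 := by
    rintro a ha rfl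
    exact ha hM0
  have s0 := hmem y hy0
  have sneg := hmem z (hne z (by omega))
  have sA := hmem x (hne x (by omega))
  have sB := hmem 1 one_ne_zero
  have sw := hmem w (hne w hw0)
  refine ⟨?_, ?_⟩
  · have hinj : Function.Injective fun m : ℤ => (m : ℂ) * q := fun m m' h =>
      Int.cast_injective (mul_right_cancel₀ (Nat.cast_ne_zero.2 (by omega : q ≠ 0)) h)
    have hfin : (weilSpectrum p L (1 + (j + 1) * (q - 1))).Finite :=
      (Set.finite_range (weilSum p L (1 + (j + 1) * (q - 1)))).subset fun _ ⟨a, _, h⟩ => ⟨a, h⟩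
    have hnd : ([y, z, x, 1, w].map (nihoValue q j)).Nodup := by
      simp only [List.map_cons, List.map_nil, hy, hz, hM1, List.nodup_cons, List.mem_cons,
        List.not_mem_nil, or_false, not_or, not_false_eq_true, List.nodup_nil, and_true]
      refine ⟨⟨?_, ?_, ?_, ?_⟩, ⟨?_, ?_, ?_⟩, ⟨fun h => ?_, ?_⟩, ?_⟩
      all_goals try omega
      rw [← h] at hBodd
      exact Int.not_even_iff_odd.2 hBodd hxe
    refine (hnd.map hinj).length_le_ncard hfin fun u hu => ?_
    simp only [List.map_cons, List.map_nil, List.mem_cons, List.not_mem_nil, or_false] at hu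
    rcases hu with rfl | rfl | rfl | rfl | rfl <;> assumption
  · obtain ⟨α, hα⟩ := hxe
    obtain ⟨β, hβ⟩ := hBodd
    lift α to ℕ using by omega
    lift β to ℕ using by omega
    refine ⟨α, β, by omega, by omega, ?_⟩
    rw [hy] at s0
    rw [hz] at sneg
    rw [hα] at sA
    rw [hM1, hβ] at sB
    push_cast at s0 sneg sA sB
    rintro u (rfl | rfl | rfl | rfl)
    · simpa using s0
    · simpa using sneg
    · rwa [two_mul]
    · exact sB
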